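/- Let $E/\mathbb{Q}$ be a finite extension with finite group $G=\mathrm{Gal}(E/\mathbb{Q})$ (the group of automorphisms of $E$; in practice $E/\mathbb Q$ is Galois). Sums over $\rho$ or $\gamma$ run over the finitely many isomorphism classes of irreducible complex representations of $G$. Let $R(G)$ be the ring of complex linear combinations, and $R(G,\mathbb{Z})$ the subset of integer linear combinations, of the irreducible characters of $G$, and let $\langle\sigma,\rho\rangle=\frac1{|G|}\sum_{g\in G}\mathrm{tr}\,\sigma(g)\,\mathrm{tr}\,\rho(g^{-1})$, the multiplicity of the irreducible representation $\rho$ in $\sigma$. For a representation $V$ of $G$, a positive integer $d$ and a primitive $d$-th root of unity $\zeta$, the cyclic tensor power $V^{\otimes_{\rm cyc}d}$ is the quotient of $V^{\otimes d}$ by the span of all $\zeta^m v-m.v$, where $m\in\mathbb{Z}/d$ acts by $m.(a_1\otimes\cdots\otimes a_d)=a_{1+m}\otimes\cdots\otimes a_{d+m}$ (indices mod $d$), with the induced action of $G$. Any choice of $\zeta$ is allowed, for each $d$. Let $Q\in 1+zR(G)[[z]]$, and for $g\in G$ let $Q_g(z)\in 1+z\mathbb{C}[[z]]$ be obtained by evaluating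 the coefficients of $Q$ at $g$; for a prime $p$ unramified in $E$ with Frobenius element $\mathrm{Fr}_p$ put $Q_p=Q_{\mathrm{Fr}_p}$. Infinite sums of power series converge $z$-adically. Then there are unique families of complex numbers $q_{n,\rho}$ and $b_{n,\rho}$ ($n\ge1$) such that, for all $g\in G$ (that is, as identities in $R(G)[[z]]$), $$\log Q_g(z)=\sum_{n\ge1}\sum_\rho q_{n,\rho}\,\mathrm{tr}\,\rho(g)\,z^n,\qquad \log Q_g(z)=-\sum_{n\ge1}\sum_\rho b_{n,\rho}\log\det\bigl(I-\rho(g)z^n\bigr);$$ in particular these hold for $Q_p$ with $g=\mathrm{Fr}_p$ at every prime $p$ unramified in $E$. Moreover: (i) Define $r_{n,\rho}$ recursively by $r_{1,\rho}=q_{1,\rho}$ and $$r_{n,\rho}=q_{n,\rho}-\sum_{\substack{d\mid n\\ d>1}}\sum_{\gamma}\frac{\langle\gamma^{\otimes d},\rho\rangle}{d}\,r_{n/d,\gamma}.$$ Then for all $n\ge1$ and all $\rho$, $$b_{n,\rho}=\sum_{d\mid n}\sum_{\gamma}\langle\gamma^{\otimes_{\rm cyc}d},\rho\rangle\,r_{n/d,\gamma}.$$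 (ii) If $Q\in 1+zR(G,\mathbb{Z})[[z]]$, then $b_{n,\rho}\in\mathbb{Z}$ for all $n\ge 1$ and all $\rho$. -/

import Mathlib

open scoped PowerSeries NumberField

noncomputable section

namespace FrobEuler

/-! ### Irreducible complex representations up to isomorphism -/

section Irreducible

variable (G : Type*) [Group G]

/-- Irreducible complex representations of `G` on some coordinate space `ℂ^m`. For a finite group
every irreducible complex representation is isomorphic to one of these. -/
structure IrrepModel where
  dim : ℕ
  rep : Representation ℂ G (Fin dim → ℂ)
  irreducible : rep.IsIrreducible

/-- Isomorphism of representations. -/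
instance IrrepModel.setoid : Setoid (IrrepModel G) where
  r ρ σ := Nonempty (ρ.rep.Equiv σ.rep)
  iseqv :=
    { refl := fun _ => ⟨Representation.Equiv.refl _⟩
      symm := fun ⟨e⟩ => ⟨e.symm⟩
      trans := fun ⟨e⟩ ⟨f⟩ => ⟨e.trans f⟩ }

/-- The set of isomorphism classes of irreducible complex representations of `G`. -/
def Irr : Type _ := Quotient (IrrepModel.setoid G)

variable {G}

/-- The dimension of an irreducible representation. -/
def Irr.dim (ρ : Irr G) : ℕ := (Quotient.out ρ).dim

/-- A representation in the isomorphism class `ρ`. -/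
def Irr.rep (ρ : Irr G) : Representation ℂ G (Fin ρ.dim → ℂ) := (Quotient.out ρ).rep

theorem Irr.rep_irreducible (ρ : Irr G) : ρ.rep.IsIrreducible := (Quotient.out ρ).irreducible

theorem Irr.eq_of_equiv {ρ σ : Irr G} (h : Nonempty (ρ.rep.Equiv σ.rep)) : ρ = σ := by
  rw [← Quotient.out_eq ρ, ← Quotient.out_eq σ]
  exact Quotient.sound h

/-- The pairing `⟨φ, ψ⟩ = |G|⁻¹ ∑_g φ(g) ψ(g⁻¹)`; for characters, `ψ(g⁻¹)` is the complex conjugate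
of `ψ(g)`, and for irreducible `ψ` this is the multiplicity of `ψ` in `φ`. -/
def charPairing [Fintype G] (φ ψ : G → ℂ) : ℂ :=
  (Nat.card G : ℂ)⁻¹ * ∑ g : G, φ g * ψ g⁻¹

theorem Irr.charPairing_eq [Fintype G] [DecidableEq (Irr G)] (ρ σ : Irr G) :
    charPairing ρ.rep.character σ.rep.character = if ρ = σ then 1 else 0 := by
  have := ρ.rep_irreducible
  have := σ.rep_irreducible
  have : Invertible (Nat.card G : ℂ) := invertibleOfNonzero (by simp)
  rw [charPairing, Representation.char_orthonormal]
  by_cases h : ρ = σ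
  · subst h
    rw [if_pos ⟨Representation.Equiv.refl _⟩, if_pos rfl]
  · rw [if_neg h, if_neg]
    intro hne
    exact h (Irr.eq_of_equiv hne).symm

theorem Irr.linearIndependent_character [Fintype G] :
    LinearIndependent ℂ (fun ρ : Irr G => (ρ.rep.character : G → ℂ)) := by
  classical
  rw [linearIndependent_iff']
  intro s a h σ hσ
  have key : charPairing (∑ ρ ∈ s, a ρ • (ρ.rep.character : G → ℂ)) σ.rep.character
      = ∑ ρ ∈ s, a ρ * charPairing ρ.rep.character σ.rep.character := by
    simp only [charPairing, Finset.sum_apply, Pi.smul_apply, smul_eq_mul, Finset.mul_sum,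
      Finset.sum_mul]
    rw [Finset.sum_comm]
    refine Finset.sum_congr rfl fun ρ _ => Finset.sum_congr rfl fun g _ => ?_
    ring
  rw [h] at key
  have h0 : charPairing (0 : G → ℂ) σ.rep.character = 0 := by simp [charPairing]
  rw [h0] at key
  simpa [Irr.charPairing_eq, hσ] using key.symm

/-- A finite group has finitely many irreducible representations. -/
instance Irr.instFinite [Fintype G] : Finite (Irr G) :=
  (Irr.linearIndependent_character (G := G)).finite

instance Irr.instFintype [Fintype G] : Fintype (Irr G) := Fintype.ofFinite _

variable (G)

/-- `R(G)`: the complex linear combinations of irreducible characters. -/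
def virtualChar : Submodule ℂ (G → ℂ) :=
  Submodule.span ℂ (Set.range fun ρ : Irr G => ρ.rep.character)

/-- `R(G, ℤ)`: the integer linear combinations of irreducible characters. -/
def integralVirtualChar : Submodule ℤ (G → ℂ) :=
  Submodule.span ℤ (Set.range fun ρ : Irr G => ρ.rep.character)

end Irreducible

/-! ### Tensor powers and cyclic tensor powers -/

section CyclicTensor

open scoped TensorProduct

variable {G V : Type*} [Group G] [AddCommGroup V] [Module ℂ V]

/-- The tensor power `ρ^{⊗ n}`, with tensor factors indexed by `ℤ/n`. -/
def tensorPow (ρ : Representation ℂ G V) (n : ℕ) :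
    Representation ℂ G (⨂[ℂ] _ : ZMod n, V) where
  toFun g := PiTensorProduct.map fun _ => ρ g
  map_one' := by
    simp only [map_one]
    exact PiTensorProduct.map_one
  map_mul' g h := by
    simp only [map_mul]
    exact PiTensorProduct.map_mul _ _

/-- The action of `m ∈ ℤ/n` on `V^{⊗ n}`, `m.(⨂ aᵢ) = ⨂ aᵢ₊ₘ`. -/
def cyclicShift (V : Type*) [AddCommGroup V] [Module ℂ V] (n : ℕ) (m : ZMod n) :
    (⨂[ℂ] _ : ZMod n, V) →ₗ[ℂ] (⨂[ℂ] _ : ZMod n, V) :=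
  (PiTensorProduct.reindex ℂ (fun _ : ZMod n => V) (Equiv.addRight m).symm).toLinearMap

theorem cyclicShift_tprod (n : ℕ) (m : ZMod n) (a : ZMod n → V) :
    cyclicShift V n m (PiTensorProduct.tprod ℂ a) = PiTensorProduct.tprod ℂ fun i => a (i + m) :=
  PiTensorProduct.reindex_tprod _ _

theorem tensorPow_cyclicShift (ρ : Representation ℂ G V) (n : ℕ) (m : ZMod n) (g : G)
    (v : ⨂[ℂ] _ : ZMod n, V) :
    tensorPow ρ n g (cyclicShift V n m v) = cyclicShift V n m (tensorPow ρ n g v) :=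
  PiTensorProduct.map_reindex (fun _ : ZMod n => ρ g) (Equiv.addRight m).symm v

/-- The subspace of `V^{⊗ n}` spanned by the vectors `ζ^m v - m.v`. -/
def cyclicRelations (V : Type*) [AddCommGroup V] [Module ℂ V] (n : ℕ) (ζ : ℂ) :
    Submodule ℂ (⨂[ℂ] _ : ZMod n, V) :=
  Submodule.span ℂ {w | ∃ (m : ℕ) (v : ⨂[ℂ] _ : ZMod n, V), w = ζ ^ m • v - cyclicShift V n m v}

theorem cyclicRelations_le_comap (ρ : Representation ℂ G V) (n : ℕ) (ζ : ℂ) (g : G) :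
    cyclicRelations V n ζ ≤ (cyclicRelations V n ζ).comap (tensorPow ρ n g) := by
  refine Submodule.span_le.mpr ?_
  rintro _ ⟨m, v, rfl⟩
  refine Submodule.subset_span ⟨m, tensorPow ρ n g v, ?_⟩
  rw [map_sub, map_smul, tensorPow_cyclicShift]

/-- The cyclic tensor power of `ρ` by `n`, formed with the primitive `n`-th root of unity `ζ`:
the representation induced by `ρ^{⊗ n}` on `V^{⊗ n} / ⟨(ζ^m - m).v⟩`. -/
def cyclicTensorPow (ρ : Representation ℂ G V) (n : ℕ) (ζ : ℂ) :
    Representation ℂ G ((⨂[ℂ] _ : ZMod n, V) ⧸ cyclicRelations V n ζ) :=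
  (tensorPow ρ n).quotient _ (cyclicRelations_le_comap ρ n ζ)

end CyclicTensor

/-! ### Formal power series -/

section Series

/-- The formal logarithm `log f = ∑_{k ≥ 1} (-1)^{k+1} (f - 1)^k / k` of a power series `f` with
constant term `1`. -/
def formalLog (f : ℂ⟦X⟧) : ℂ⟦X⟧ := (PowerSeries.log ℂ).subst (f - 1)

/-- The power series `det(I - A z^n)`. -/
def detSeries {V : Type*} [AddCommGroup V] [Module ℂ V] (A : V →ₗ[ℂ] V) (n : ℕ) : ℂ⟦X⟧ :=
  LinearMap.det (LinearMap.id - (PowerSeries.X ^ n : ℂ⟦X⟧) • A.baseChange ℂ⟦X⟧)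

/-- `s = ∑_{n ≥ 1} f n` in the `z`-adic topology: each coefficient of the partial sums is
eventually equal to that of `s`. -/
def HasSeriesSum (f : ℕ → ℂ⟦X⟧) (s : ℂ⟦X⟧) : Prop :=
  ∀ m : ℕ, ∀ᶠ N in Filter.atTop,
    PowerSeries.coeff m (∑ n ∈ Finset.Icc 1 N, f n) = PowerSeries.coeff m s

variable {G : Type*} [Group G] [Fintype G]

/-- The complex power series obtained by evaluating the coefficients of `Q` at `g ∈ G`. When `g`
is a Frobenius element at `p`, this is `Q_p(z)`. -/
def evalAt (Q : (G → ℂ)⟦X⟧) (g : G) : ℂ⟦X⟧ := Q.map (Pi.evalRingHom (fun _ : G => ℂ) g)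

/-- `log Q = ∑_{n ≥ 1} ∑_ρ q_{n,ρ} tr ρ(g) z^n` at the element `g`. -/
def TraceExpansionAt (Q : (G → ℂ)⟦X⟧) (q : ℕ → Irr G → ℂ) (g : G) : Prop :=
  HasSeriesSum
    (fun n => ∑ ρ : Irr G, (q n ρ * ρ.rep.character g) • (PowerSeries.X ^ n : ℂ⟦X⟧))
    (formalLog (evalAt Q g))

/-- `log Q = - ∑_{n ≥ 1} ∑_ρ b_{n,ρ} log det(I - ρ(g) z^n)` at the element `g`. -/
def DetExpansionAt (Q : (G → ℂ)⟦X⟧) (b : ℕ → Irr G → ℂ) (g : G) : Prop :=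
  HasSeriesSum
    (fun n => -∑ ρ : Irr G, b n ρ • formalLog (detSeries (ρ.rep g) n))
    (formalLog (evalAt Q g))

/-- The recursive sequence
`r_{n,ρ} = q_{n,ρ} - ∑_{d ∣ n, d > 1} ∑_γ (⟨γ^{⊗ d}, ρ⟩ / d) r_{n/d,γ}` for `n ≥ 1`. -/
def rSeq (q : ℕ → Irr G → ℂ) (n : ℕ) (ρ : Irr G) : ℂ :=
  q n ρ - ∑ d ∈ (n.divisors.filter (1 < ·)).attach, ∑ γ : Irr G,
    charPairing (tensorPow γ.rep d.1).character ρ.rep.character / (d.1 : ℂ) * rSeq q (n / d.1) γ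
termination_by n
decreasing_by
  have hd := d.2
  rw [Finset.mem_filter, Nat.mem_divisors] at hd
  exact Nat.div_lt_self (Nat.pos_of_ne_zero hd.1.2) hd.2

theorem rSeq_eq (q : ℕ → Irr G → ℂ) (n : ℕ) (ρ : Irr G) :
    rSeq q n ρ = q n ρ - ∑ d ∈ n.divisors.filter (1 < ·), ∑ γ : Irr G,
      charPairing (tensorPow γ.rep d).character ρ.rep.character / (d : ℂ) * rSeq q (n / d) γ := by
  rw [rSeq, ← Finset.sum_attach (n.divisors.filter (1 < ·))]

theorem rSeq_one (q : ℕ → Irr G → ℂ) (ρ : Irr G) : rSeq q 1 ρ = q 1 ρ := by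
  rw [rSeq_eq]
  simp [Finset.filter_singleton]

end Series

/-- `σ` is a Frobenius element at the prime number `p`, which is unramified in `E`: there is a prime
`P` of `E` above `p` with trivial inertia group at which `σ` is the Frobenius. Here the inertia
group acts trivially on every representation `V`, so that `V^{I_p} = V`. -/
def IsFrobAtUnramified (E : Type*) [Field E] [NumberField E] (p : ℕ) (σ : Gal(E/ℚ)) : Prop :=
  p.Prime ∧ ∃ P : Ideal (𝓞 E), P.IsPrime ∧ P.LiesOver (Ideal.span {(p : ℤ)}) ∧
    P.inertia Gal(E/ℚ) = ⊥ ∧ IsArithFrobAt ℤ σ P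

end FrobEuler

end

/-
Work in `R(G)[[z]]` with the Adams operations `ψ^d φ (g) = φ (g ^ d)`. Expanding `log det` over the
eigenvalues of `ρ(g)` turns the second expansion into `∑_{d ∣ n} ψ^d(B_{n/d}) / d = (log Q)_n` with
`B_m = ∑_ρ b_{m,ρ} χ_ρ`; its `d = 1` term determines `B_n` from the previous ones. The recursion for
`r` is `(log Q)_n = ∑_{d ∣ n} ∑_γ r_{n/d,γ} χ_γ^d / d`, i.e. `Q = ∏_{n,γ} (1 - χ_γ z^n)^{-r_{n,γ}}`.
Averaging the cyclic shifts against a primitive root of unity gives the character of a cyclic tensor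
power, `d χ_cyc(g) = ∑_{e ∣ d} μ(e) χ(g ^ e)^{d/e}`, and Möbius inversion then yields
`∑_{d ∣ n} ψ^d(χ_{γ^{⊗cyc n/d}}) / d = χ_γ^n / n`, so `B_n = ∑_{d ∣ n} ∑_γ r_{n/d,γ} χ_{γ^{⊗cyc d}}`
solves the equation for the `B_n`. If `Q` has integral coefficients, dividing it by the factors
`(1 - χ_γ z^m)^{-r_{m,γ}}` with `m < n` leaves a series with coefficients in the ring `R(G, ℤ)` and
first nontrivial coefficient `∑_γ r_{n,γ} χ_γ`, so the `r_{n,γ}` are integers by induction.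
-/

noncomputable section

namespace FrobEuler

section Trace

variable {K V : Type*} [Field K] [AddCommGroup V] [Module K V]

theorem trace_mapQ_eq_trace_comp [FiniteDimensional K V] {W : Submodule K V} {T P : V →ₗ[K] V}
    (hT : W ≤ W.comap T) (hker : W ≤ LinearMap.ker P) (hP : ∀ v, P v - v ∈ W) :
    LinearMap.trace K (V ⧸ W) (W.mapQ W T hT) = LinearMap.trace K V (T ∘ₗ P) := by
  have hsection : W.mkQ ∘ₗ W.liftQ P hker = LinearMap.id :=
    Submodule.linearMap_qext _ <| LinearMap.ext fun v => (Submodule.Quotient.eq W).mpr (hP v)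
  calc LinearMap.trace K (V ⧸ W) (W.mapQ W T hT)
      = LinearMap.trace K (V ⧸ W) (W.mkQ ∘ₗ (T ∘ₗ W.liftQ P hker)) := by
        rw [← LinearMap.comp_assoc, ← W.mapQ_mkQ W T (h := hT), LinearMap.comp_assoc, hsection,
          LinearMap.comp_id]
    _ = LinearMap.trace K V ((T ∘ₗ W.liftQ P hker) ∘ₗ W.mkQ) := LinearMap.trace_comp_comm' _ _
    _ = LinearMap.trace K V (T ∘ₗ P) := by rw [LinearMap.comp_assoc, W.liftQ_mkQ]

theorem trace_eq_trace_restrict_add_trace_mapQ [FiniteDimensional K V] {W : Submodule K V}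
    {f : V →ₗ[K] V} (hf : W ≤ W.comap f) :
    LinearMap.trace K V f =
      LinearMap.trace K W (f.restrict hf) + LinearMap.trace K (V ⧸ W) (W.mapQ W f hf) := by
  obtain ⟨U, hWU⟩ := W.exists_isCompl
  let π := W.projection U hWU
  have hπ : ∀ v, π v ∈ W := Submodule.projection_apply_mem hWU
  have hfπ : ∀ v, (f ∘ₗ π) v ∈ W := fun v => hf (hπ v)
  have hrestrict : f.restrict hf = (f ∘ₗ π).restrict fun v _ => hfπ v := by
    ext w
    simp [π]
  have hmapQ : LinearMap.trace K (V ⧸ W) (W.mapQ W f hf) = LinearMap.trace K V (f ∘ₗ (1 - π)) :=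
    trace_mapQ_eq_trace_comp hf
      (fun w hw => by simp [π, Submodule.projection_apply_left hWU ⟨w, hw⟩])
      fun v => by simpa using hπ v
  rw [hmapQ, hrestrict, LinearMap.trace_restrict_eq_of_forall_mem _ _ hfπ, ← map_add,
    ← LinearMap.comp_add, add_sub_cancel, Module.End.one_eq_id, LinearMap.comp_id]

theorem exists_eigenbasis_of_pow_eq_one [IsAlgClosed K] [FiniteDimensional K V]
    {f : Module.End K V} {n : ℕ} (hn : (n : K) ≠ 0) (hf : f ^ n = 1) :
    ∃ (b : Module.Basis (Fin (Module.finrank K V)) K V) (l : Fin (Module.finrank K V) → K),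
      ∀ i, f (b i) = l i • b i := by
  classical
  have hss : f.IsSemisimple := by
    refine Module.End.isSemisimple_of_squarefree_aeval_eq_zero (p := Polynomial.X ^ n - 1) ?_ ?_
    · simpa using (Polynomial.separable_X_pow_sub_C (1 : K) hn one_ne_zero).squarefree
    · simp [hf]
  have hint : DirectSum.IsInternal f.eigenspace :=
    DirectSum.isInternal_submodule_of_iSupIndep_of_iSup_eq_top f.eigenspaces_iSupIndep
      hss.iSup_eigenspace_eq_top
  let b := hint.collectedBasis fun μ => Module.finBasis K (f.eigenspace μ)
  have := FiniteDimensional.fintypeBasisIndex b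
  let e := Fintype.equivFinOfCardEq (Module.finrank_eq_card_basis b).symm
  refine ⟨b.reindex e, fun i => (e.symm i).1, fun i => ?_⟩
  rw [Module.Basis.reindex_apply]
  exact Module.End.mem_eigenspace_iff.mp (hint.collectedBasis_mem _ _)

theorem exists_eigenbasis_of_representation [IsAlgClosed K] [CharZero K] [FiniteDimensional K V]
    {G : Type*} [Group G] [Finite G] (ρ : Representation K G V) (g : G) :
    ∃ (b : Module.Basis (Fin (Module.finrank K V)) K V) (l : Fin (Module.finrank K V) → K),
      ∀ i, ρ g (b i) = l i • b i :=
  exists_eigenbasis_of_pow_eq_one (Nat.cast_ne_zero.mpr (Nat.card_pos (α := G)).ne')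
    (by rw [← map_pow, pow_card_eq_one', map_one])

theorem trace_pow_of_eigenbasis {ι : Type*} [Fintype ι] (b : Module.Basis ι K V)
    {f : Module.End K V} {l : ι → K} (hl : ∀ i, f (b i) = l i • b i) (k : ℕ) :
    LinearMap.trace K V (f ^ k) = ∑ i, l i ^ k := by
  classical
  have hpow : ∀ i, (f ^ k) (b i) = l i ^ k • b i := fun i => by
    induction k with
    | zero => simp
    | succ k ih => rw [pow_succ', Module.End.mul_apply, ih, map_smul, hl, smul_smul, pow_succ]
  simp [LinearMap.trace_eq_matrix_trace K b, Matrix.trace, LinearMap.toMatrix_apply, hpow]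

end Trace

section Characters

variable {G : Type*} [Group G] {V : Type*} [AddCommGroup V] [Module ℂ V]

theorem isIrreducible_of_equiv {K W U : Type*} [Field K] [AddCommGroup W] [Module K W]
    [AddCommGroup U] [Module K U] {σ : Representation K G W} {τ : Representation K G U}
    [σ.IsIrreducible] (φ : σ.Equiv τ) : τ.IsIrreducible := by
  let ψ := Representation.IntertwiningMap.equivLinearMapAsModule τ σ φ.symm.toIntertwiningMap
  rw [Representation.irreducible_iff_isSimpleModule_asModule]
  exact IsSimpleModule.congr (LinearEquiv.ofBijective ψ (EquivLike.bijective φ.symm))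

theorem character_mem_range_of_isIrreducible [FiniteDimensional ℂ V] (σ : Representation ℂ G V)
    [σ.IsIrreducible] : ∃ ρ : Irr G, ρ.rep.character = σ.character := by
  let e : V ≃ₗ[ℂ] (Fin (Module.finrank ℂ V) → ℂ) := (Module.finBasis ℂ V).equivFun
  let τ : Representation ℂ G (Fin (Module.finrank ℂ V) → ℂ) :=
    (e.conjAlgEquiv ℂ : _ →* _).comp σ
  let φ : σ.Equiv τ := .mk e fun g => by ext v : 1; simp [τ]
  let M : IrrepModel G := ⟨_, τ, isIrreducible_of_equiv φ⟩
  obtain ⟨ψ⟩ : Nonempty ((Irr.rep (Quotient.mk _ M)).Equiv τ) := Quotient.mk_out M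
  exact ⟨Quotient.mk _ M, (Representation.char_iso ψ).trans (Representation.char_iso φ).symm⟩

theorem exists_subrepresentation_of_not_isIrreducible [Nontrivial V] {σ : Representation ℂ G V}
    (hσ : ¬ σ.IsIrreducible) :
    ∃ W : Subrepresentation σ, W.toSubmodule ≠ ⊥ ∧ W.toSubmodule ≠ ⊤ := by
  by_contra! hW
  have : Nontrivial (Subrepresentation σ) :=
    ⟨⊥, ⊤, fun h => bot_ne_top (congrArg Subrepresentation.toSubmodule h)⟩
  exact hσ <| .of_forall_eq_top fun W hW0 =>
    Subrepresentation.toSubmodule_injective <|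
      hW W fun h => hW0 (Subrepresentation.toSubmodule_injective h)

theorem character_mem_integralVirtualChar [FiniteDimensional ℂ V] (σ : Representation ℂ G V) :
    σ.character ∈ integralVirtualChar G := by
  induction hn : Module.finrank ℂ V using Nat.strong_induction_on generalizing V with
  | _ n ih =>
    by_cases hσ : σ.IsIrreducible
    · exact Submodule.subset_span (character_mem_range_of_isIrreducible σ)
    rcases subsingleton_or_nontrivial V with hV | hV
    · have hzero : σ.character = 0 := by
        ext g
        simp [Representation.character, Subsingleton.elim (σ g) 0]
      exact hzero ▸ zero_mem _
    obtain ⟨W, hW0, hW1⟩ := exists_subrepresentation_of_not_isIrreducible hσ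
    have hstable : ∀ g, W.toSubmodule ≤ W.toSubmodule.comap (σ g) := W.apply_mem_toSubmodule
    have hfinrank := W.toSubmodule.finrank_quotient_add_finrank
    have hpos := Nat.pos_of_ne_zero (mt Submodule.finrank_eq_zero.mp hW0)
    have hlt := Submodule.finrank_lt hW1
    have hadd : σ.character =
        W.toRepresentation.character + (σ.quotient W.toSubmodule hstable).character :=
      funext fun g => trace_eq_trace_restrict_add_trace_mapQ (hstable g)
    rw [hadd]
    exact add_mem (ih _ (by omega) _ rfl) (ih _ (by omega) _ rfl)

theorem mul_mem_integralVirtualChar {φ ψ : G → ℂ} (hφ : φ ∈ integralVirtualChar G)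
    (hψ : ψ ∈ integralVirtualChar G) : φ * ψ ∈ integralVirtualChar G := by
  have hmul : integralVirtualChar G * integralVirtualChar G ≤ integralVirtualChar G := by
    rw [integralVirtualChar, Submodule.span_mul_span, Submodule.span_le]
    rintro _ ⟨_, ⟨ρ, rfl⟩, _, ⟨σ, rfl⟩, rfl⟩
    beta_reduce
    rw [← Representation.char_tensor]
    exact character_mem_integralVirtualChar _
  exact hmul (Submodule.mul_mem_mul hφ hψ)

theorem one_mem_integralVirtualChar : 1 ∈ integralVirtualChar G := by
  have htrivial : (Representation.trivial ℂ G ℂ).character = 1 := by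
    ext g
    simp [Representation.character]
  exact htrivial ▸ character_mem_integralVirtualChar _

variable (G) in
/-- The ring structure on `R(G, ℤ)`, with the product of characters coming from the tensor product
of representations. -/
def integralVirtualCharRing : Subring (G → ℂ) where
  carrier := integralVirtualChar G
  mul_mem' := mul_mem_integralVirtualChar
  one_mem' := one_mem_integralVirtualChar
  add_mem' := add_mem
  zero_mem' := zero_mem _
  neg_mem' := neg_mem

variable (G) in
/-- The `ℂ`-algebra structure on `R(G)`. -/
def virtualCharAlgebra : Subalgebra ℂ (G → ℂ) :=
  Algebra.adjoin ℂ (integralVirtualChar G)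

theorem integralVirtualChar_subset_virtualChar :
    (integralVirtualChar G : Set (G → ℂ)) ⊆ virtualChar G :=
  Submodule.span_le_restrictScalars ℤ ℂ _

theorem toSubmodule_virtualCharAlgebra :
    (virtualCharAlgebra G).toSubmodule = virtualChar G := by
  have hclosure : Submonoid.closure (integralVirtualChar G : Set (G → ℂ)) =
      (integralVirtualCharRing G).toSubmonoid :=
    Submonoid.closure_eq (integralVirtualCharRing G).toSubmonoid
  rw [virtualCharAlgebra, Algebra.adjoin_eq_span, hclosure]
  exact le_antisymm (Submodule.span_le.mpr integralVirtualChar_subset_virtualChar)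
    (Submodule.span_mono Submodule.subset_span)

end Characters

section Multiplicities

variable {G : Type*} [Group G] [Fintype G]

variable (G) in
/-- The class function `∑_ρ a_ρ χ_ρ` with coefficient family `a`. -/
def charCombination : (Irr G → ℂ) →ₗ[ℂ] (G → ℂ) :=
  Fintype.linearCombination ℂ fun ρ : Irr G => ρ.rep.character

/-- The family `⟨φ, χ_ρ⟩`, indexed by the irreducible representations `ρ`. -/
def multiplicities (φ : G → ℂ) (ρ : Irr G) : ℂ := charPairing φ ρ.rep.character

theorem charCombination_apply (a : Irr G → ℂ) :
    charCombination G a = ∑ ρ, a ρ • ρ.rep.character :=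
  rfl

theorem multiplicities_charCombination (a : Irr G → ℂ) :
    multiplicities (charCombination G a) = a := by
  classical
  ext ρ
  calc multiplicities (charCombination G a) ρ
      = ∑ γ, a γ * charPairing γ.rep.character ρ.rep.character := by
        simp only [multiplicities, charCombination_apply, charPairing, Finset.sum_apply,
          Pi.smul_apply, smul_eq_mul, Finset.mul_sum, Finset.sum_mul]
        rw [Finset.sum_comm]
        exact Finset.sum_congr rfl fun γ _ => Finset.sum_congr rfl fun g _ => by ring
    _ = a ρ := by simp [Irr.charPairing_eq]

theorem charCombination_injective : Function.Injective (charCombination G) :=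
  Function.LeftInverse.injective multiplicities_charCombination

theorem charCombination_multiplicities {φ : G → ℂ} (hφ : φ ∈ virtualChar G) :
    charCombination G (multiplicities φ) = φ := by
  rw [virtualChar, ← Fintype.range_linearCombination] at hφ
  obtain ⟨a, rfl⟩ := hφ
  exact congrArg (charCombination G) (multiplicities_charCombination a)

theorem exists_int_of_charCombination_mem {a : Irr G → ℂ}
    (ha : charCombination G a ∈ integralVirtualChar G) (ρ : Irr G) : ∃ k : ℤ, a ρ = k := by
  obtain ⟨k, hk⟩ := (Submodule.mem_span_range_iff_exists_fun ℤ).mp ha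
  refine ⟨k ρ, congrFun (charCombination_injective ?_ : a = fun ρ => (k ρ : ℂ)) ρ⟩
  simp only [← hk, charCombination_apply, Int.cast_smul_eq_zsmul]

theorem charCombination_multiplicities_character {V : Type*} [AddCommGroup V] [Module ℂ V]
    [FiniteDimensional ℂ V] (σ : Representation ℂ G V) :
    charCombination G (multiplicities σ.character) = σ.character :=
  charCombination_multiplicities
    (integralVirtualChar_subset_virtualChar (character_mem_integralVirtualChar σ))

theorem exists_int_multiplicities_character {V : Type*} [AddCommGroup V] [Module ℂ V]
    [FiniteDimensional ℂ V] (σ : Representation ℂ G V) (ρ : Irr G) :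
    ∃ k : ℤ, multiplicities σ.character ρ = k :=
  exists_int_of_charCombination_mem
    ((charCombination_multiplicities_character σ).symm ▸ character_mem_integralVirtualChar σ) ρ

end Multiplicities

section PeriodicFunctions

variable {A : Type*} [AddCommGroup A]

/-- The functions with period `m` as the functions on the quotient by the subgroup generated by
`m`. -/
def periodicEquiv (m : A) (ι : Type*) :
    {p : A → ι // Function.Periodic p m} ≃ (A ⧸ AddSubgroup.zmultiples m → ι) where
  toFun p := p.2.lift
  invFun p := ⟨fun a => p a, fun a => congrArg p <| (QuotientAddGroup.eq).mpr (by simp)⟩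
  left_inv p := rfl
  right_inv p := funext fun a => QuotientAddGroup.induction_on a fun _ => rfl

theorem prod_quotient_addSubgroup [Fintype A] {M : Type*} [CommMonoid M] (H : AddSubgroup A)
    [Fintype (A ⧸ H)] (F : A ⧸ H → M) : ∏ a : A, F a = ∏ q, F q ^ Nat.card H := by
  have : Fintype H := Fintype.ofFinite H
  rw [Fintype.prod_equiv AddSubgroup.addGroupEquivQuotientProdAddSubgroup (fun a : A => F a)
    (fun p : (A ⧸ H) × H => F p.1) fun _ => rfl, Fintype.prod_prod_type]
  simp

theorem sum_prod_of_periodic [Fintype A] {ι R : Type*} [Fintype ι] [CommSemiring R] (l : ι → R)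
    (m : A) [Fintype {p : A → ι // Function.Periodic p m}] :
    ∑ p : {p : A → ι // Function.Periodic p m}, ∏ a, l (p.1 a) =
      (∑ j, l j ^ addOrderOf m) ^ (Fintype.card A / addOrderOf m) := by
  have hcard : Fintype.card (A ⧸ AddSubgroup.zmultiples m) = Fintype.card A / addOrderOf m := by
    have hlagrange := (AddSubgroup.zmultiples m).card_eq_card_quotient_mul_card_addSubgroup
    rw [Nat.card_zmultiples, Nat.card_eq_fintype_card, Nat.card_eq_fintype_card] at hlagrange
    rw [hlagrange, Nat.mul_div_cancel _ (addOrderOf_pos m)]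
  calc ∑ p : {p : A → ι // Function.Periodic p m}, ∏ a, l (p.1 a)
      = ∑ p : A ⧸ AddSubgroup.zmultiples m → ι, ∏ a : A, l (p a) :=
        Fintype.sum_equiv (periodicEquiv m ι) _ _ fun _ => rfl
    _ = ∑ p : A ⧸ AddSubgroup.zmultiples m → ι, ∏ c, l (p c) ^ addOrderOf m := by
        simp_rw [fun p : A ⧸ AddSubgroup.zmultiples m → ι =>
          prod_quotient_addSubgroup _ fun c => l (p c), Nat.card_zmultiples]
    _ = (∑ j, l j ^ addOrderOf m) ^ (Fintype.card A / addOrderOf m) := by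
        rw [← hcard, ← Finset.card_univ, ← Finset.prod_const, Finset.prod_univ_sum,
          Fintype.piFinset_univ]

end PeriodicFunctions

section RootsOfUnity

open scoped ArithmeticFunction.Moebius

variable {R : Type*} [CommRing R] {d : ℕ} [NeZero d] {ζ : R}

/-- The additive character of `ℤ/d` that maps `1` to the primitive root of unity `ζ`. -/
def rootChar (hζ : IsPrimitiveRoot ζ d) : AddChar (ZMod d) R :=
  AddChar.zmodChar d hζ.pow_eq_one

theorem rootChar_natCast (hζ : IsPrimitiveRoot ζ d) (k : ℕ) : rootChar hζ k = ζ ^ k :=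
  AddChar.zmodChar_apply' _ _

theorem rootChar_injective (hζ : IsPrimitiveRoot ζ d) : Function.Injective (rootChar hζ) :=
  fun a b hab => ZMod.val_injective d (hζ.pow_inj a.val_lt b.val_lt hab)

theorem orderOf_rootChar (hζ : IsPrimitiveRoot ζ d) (m : ZMod d) :
    orderOf (rootChar hζ m) = addOrderOf m := by
  rw [← addOrderOf_ofMul_eq_orderOf]
  exact addOrderOf_injective (rootChar hζ).toAddMonoidHom (rootChar_injective hζ) m

variable [IsDomain R]

theorem sum_rootChar (hζ : IsPrimitiveRoot ζ d) {M : Type*} [AddCommMonoid M] (F : R → M) :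
    ∑ m, F (rootChar hζ m) = ∑ e ∈ d.divisors, ∑ x ∈ primitiveRoots e R, F x := by
  classical
  have himage : Finset.univ.image (rootChar hζ) = Polynomial.nthRootsFinset d 1 := by
    refine Finset.eq_of_subset_of_card_le (Finset.image_subset_iff.mpr fun m _ => ?_) ?_
    · rw [Polynomial.mem_nthRootsFinset (NeZero.pos d), ← AddChar.map_nsmul_eq_pow]
      simp
    · rw [hζ.card_nthRootsFinset, Finset.card_image_of_injective _ (rootChar_injective hζ)]
      simp
  rw [← Finset.sum_biUnion fun i _ j _ h => IsPrimitiveRoot.disjoint h,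
    ← IsPrimitiveRoot.nthRoots_one_eq_biUnion_primitiveRoots, ← himage,
    Finset.sum_image (rootChar_injective hζ).injOn]

theorem sum_divisors_sum_primitiveRoots (hζ : IsPrimitiveRoot ζ d) :
    ∑ e ∈ d.divisors, ∑ x ∈ primitiveRoots e R, x = if d = 1 then 1 else 0 := by
  rw [← sum_rootChar hζ fun x => x]
  split_ifs with hd
  · subst hd
    rw [Fintype.sum_unique, Subsingleton.elim default 0, AddChar.map_zero_eq_one]
  · refine AddChar.sum_eq_zero_of_ne_one fun htrivial => hd ?_
    have hone : ζ = 1 := by simpa [htrivial] using (rootChar_natCast hζ 1).symm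
    rw [hζ.eq_orderOf, hone, orderOf_one]

theorem sum_primitiveRoots_eq_moebius (hζ : IsPrimitiveRoot ζ d) :
    ∑ x ∈ primitiveRoots d R, x = μ d := by
  have hsum : ∀ n > 0, n ∈ {n | n ∣ d} →
      ∑ i ∈ n.divisors, ∑ x ∈ primitiveRoots i R, x = if n = 1 then 1 else 0 := by
    rintro n hn ⟨k, hk⟩
    have : NeZero n := ⟨hn.ne'⟩
    exact sum_divisors_sum_primitiveRoots (hζ.pow (NeZero.pos d) (hk.trans (mul_comm n k)))
  rw [← (ArithmeticFunction.sum_eq_iff_sum_mul_moebius_eq_on {n | n ∣ d}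
    fun _ _ h₁ h₂ => h₁.trans h₂).mp hsum d (NeZero.pos d) dvd_rfl,
    Finset.sum_eq_single (d, 1)]
  · simp
  · rintro ⟨a, b⟩ hab hne
    rw [if_neg, mul_zero]
    rintro rfl
    exact hne (by simpa using (Nat.mem_divisorsAntidiagonal.mp hab).1)
  · simp [NeZero.ne d]

theorem sum_rootChar_neg_mul (hζ : IsPrimitiveRoot ζ d) (h : ℕ → R) :
    ∑ m, rootChar hζ (-m) * h (addOrderOf m) = ∑ e ∈ d.divisors, μ e * h e := by
  rw [← Equiv.sum_comp (Equiv.neg (ZMod d))]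
  simp only [Equiv.neg_apply, neg_neg, addOrderOf_neg]
  simp only [← orderOf_rootChar hζ]
  rw [sum_rootChar hζ fun x => x * h (orderOf x)]
  refine Finset.sum_congr rfl fun e he => ?_
  have : NeZero e := ⟨(Nat.pos_of_mem_divisors he).ne'⟩
  obtain ⟨k, hk⟩ := Nat.dvd_of_mem_divisors he
  rw [← sum_primitiveRoots_eq_moebius (hζ.pow (NeZero.pos d) (hk.trans (mul_comm e k))),
    Finset.sum_mul]
  refine Finset.sum_congr rfl fun x hx => ?_
  rw [← (isPrimitiveRoot_of_mem_primitiveRoots hx).eq_orderOf]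

end RootsOfUnity

section CyclicTensorPower

open scoped TensorProduct ArithmeticFunction.Moebius

variable {V : Type*} [AddCommGroup V] [Module ℂ V] {d : ℕ}

theorem cyclicShift_zero : cyclicShift V d 0 = LinearMap.id := by
  ext a
  exact (cyclicShift_tprod d 0 a).trans (congrArg _ (funext fun i => congrArg a (add_zero i)))

theorem cyclicShift_cyclicShift (m k : ZMod d) (v : ⨂[ℂ] _ : ZMod d, V) :
    cyclicShift V d m (cyclicShift V d k v) = cyclicShift V d (m + k) v := by
  have hcomp : cyclicShift V d m ∘ₗ cyclicShift V d k = cyclicShift V d (m + k) := by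
    ext a
    simp only [LinearMap.compMultilinearMap_apply, LinearMap.comp_apply, cyclicShift_tprod]
    exact congrArg _ (funext fun i => congrArg a (add_assoc i m k))
  exact LinearMap.congr_fun hcomp v

variable [NeZero d]

theorem trace_map_comp_cyclicShift {ι : Type*} [Finite ι] (b : Module.Basis ι ℂ V)
    {f : Module.End ℂ V} {l : ι → ℂ} (hl : ∀ i, f (b i) = l i • b i) (m : ZMod d) :
    LinearMap.trace ℂ _ (PiTensorProduct.map (fun _ : ZMod d => f) ∘ₗ cyclicShift V d m) =
      LinearMap.trace ℂ V (f ^ addOrderOf m) ^ (d / addOrderOf m) := by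
  classical
  have := Fintype.ofFinite ι
  let B := Basis.piTensorProduct fun _ : ZMod d => b
  have happly : ∀ p : ZMod d → ι, (PiTensorProduct.map (fun _ => f) ∘ₗ cyclicShift V d m) (B p) =
      (∏ i, l (p i)) • B fun i => p (i + m) := fun p => by
    simp only [B, LinearMap.comp_apply, Basis.piTensorProduct_apply, cyclicShift_tprod,
      PiTensorProduct.map_tprod, hl, MultilinearMap.map_smul_univ]
    exact congrArg (· • _) (Equiv.prod_comp (Equiv.addRight m) fun i => l (p i))
  calc LinearMap.trace ℂ _ (PiTensorProduct.map (fun _ : ZMod d => f) ∘ₗ cyclicShift V d m)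
      = ∑ p : ZMod d → ι, if Function.Periodic p m then ∏ i, l (p i) else 0 := by
        rw [LinearMap.trace_eq_matrix_trace ℂ B, Matrix.trace]
        refine Finset.sum_congr rfl fun p _ => ?_
        rw [Matrix.diag_apply, LinearMap.toMatrix_apply, happly, map_smul, B.repr_self,
          Finsupp.smul_apply, Finsupp.single_apply, smul_eq_mul, mul_ite, mul_one, mul_zero]
        exact if_congr funext_iff rfl rfl
    _ = ∑ p : {p : ZMod d → ι // Function.Periodic p m}, ∏ i, l (p.1 i) := by
        rw [← Finset.sum_filter, ← Finset.sum_subtype_eq_sum_filter, Finset.subtype_univ]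
    _ = LinearMap.trace ℂ V (f ^ addOrderOf m) ^ (d / addOrderOf m) := by
        rw [trace_pow_of_eigenbasis b hl, sum_prod_of_periodic l m, ZMod.card]

/-- The projection of `V^{⊗ d}` onto the `ζ`-eigenspace of the cyclic shift by `1`, whose kernel is
`cyclicRelations V d ζ`. -/
def cyclicProj (V : Type*) [AddCommGroup V] [Module ℂ V] {ζ : ℂ} (hζ : IsPrimitiveRoot ζ d) :
    (⨂[ℂ] _ : ZMod d, V) →ₗ[ℂ] (⨂[ℂ] _ : ZMod d, V) :=
  (d : ℂ)⁻¹ • ∑ m, rootChar hζ (-m) • cyclicShift V d m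

theorem cyclicProj_apply {ζ : ℂ} (hζ : IsPrimitiveRoot ζ d) (v : ⨂[ℂ] _ : ZMod d, V) :
    cyclicProj V hζ v = (d : ℂ)⁻¹ • ∑ m, rootChar hζ (-m) • cyclicShift V d m v := by
  simp only [cyclicProj, LinearMap.smul_apply, LinearMap.sum_apply]

theorem cyclicRelations_le_ker_cyclicProj {ζ : ℂ} (hζ : IsPrimitiveRoot ζ d) :
    cyclicRelations V d ζ ≤ LinearMap.ker (cyclicProj V hζ) := by
  refine Submodule.span_le.mpr ?_
  rintro _ ⟨k, v, rfl⟩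
  rw [SetLike.mem_coe, LinearMap.mem_ker, map_sub, sub_eq_zero, map_smul, cyclicProj_apply,
    cyclicProj_apply, smul_comm, ← Equiv.sum_comp (Equiv.addRight (k : ZMod d)), Finset.smul_sum]
  congr 1
  refine Finset.sum_congr rfl fun m _ => ?_
  rw [cyclicShift_cyclicShift, smul_smul, Equiv.coe_addRight, ← rootChar_natCast hζ,
    ← AddChar.map_add_eq_mul, neg_add_rev, add_neg_cancel_left]

theorem cyclicProj_sub_mem_cyclicRelations {ζ : ℂ} (hζ : IsPrimitiveRoot ζ d)
    (v : ⨂[ℂ] _ : ZMod d, V) : cyclicProj V hζ v - v ∈ cyclicRelations V d ζ := by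
  have hrelation : ∀ m, cyclicShift V d m v - rootChar hζ m • v ∈ cyclicRelations V d ζ :=
    fun m => by
      rw [← neg_sub]
      refine neg_mem (Submodule.subset_span ⟨m.val, v, ?_⟩)
      rw [← rootChar_natCast hζ, ZMod.natCast_zmod_val]
  have haverage : cyclicProj V hζ v - v = (d : ℂ)⁻¹ • ∑ m, rootChar hζ (-m) •
      (cyclicShift V d m v - rootChar hζ m • v) := by
    simp [cyclicProj_apply, smul_sub, smul_smul, ← AddChar.map_add_eq_mul,
      ← Nat.cast_smul_eq_nsmul ℂ, NeZero.ne d]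
  rw [haverage]
  exact Submodule.smul_mem _ _ <| Submodule.sum_mem _ fun m _ =>
    Submodule.smul_mem _ _ (hrelation m)

variable [FiniteDimensional ℂ V] {G : Type*} [Group G] [Finite G] (ρ : Representation ℂ G V)

theorem trace_tensorPow_comp_cyclicShift (g : G) (m : ZMod d) :
    LinearMap.trace ℂ _ (tensorPow ρ d g ∘ₗ cyclicShift V d m) =
      ρ.character (g ^ addOrderOf m) ^ (d / addOrderOf m) := by
  obtain ⟨b, l, hl⟩ := exists_eigenbasis_of_representation ρ g
  rw [Representation.character, map_pow]
  exact trace_map_comp_cyclicShift b hl m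

variable (d) in
theorem character_tensorPow : (tensorPow ρ d).character = ρ.character ^ d := by
  ext g
  have htrace := trace_tensorPow_comp_cyclicShift ρ g (0 : ZMod d)
  rwa [cyclicShift_zero, LinearMap.comp_id, addOrderOf_zero, pow_one, Nat.div_one] at htrace

theorem character_cyclicTensorPow {ζ : ℂ} (hζ : IsPrimitiveRoot ζ d) (g : G) :
    (cyclicTensorPow ρ d ζ).character g =
      (d : ℂ)⁻¹ * ∑ e ∈ d.divisors, μ e * ρ.character (g ^ e) ^ (d / e) := by
  calc (cyclicTensorPow ρ d ζ).character g
      = LinearMap.trace ℂ _ (tensorPow ρ d g ∘ₗ cyclicProj V hζ) :=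
        trace_mapQ_eq_trace_comp (cyclicRelations_le_comap ρ d ζ g)
          (cyclicRelations_le_ker_cyclicProj hζ) (cyclicProj_sub_mem_cyclicRelations hζ)
    _ = (d : ℂ)⁻¹ * ∑ m, rootChar hζ (-m) *
          LinearMap.trace ℂ _ (tensorPow ρ d g ∘ₗ cyclicShift V d m) := by
        simp only [cyclicProj, ← Module.End.mul_eq_comp, mul_smul_comm, Finset.mul_sum, map_smul,
          map_sum, smul_eq_mul]
    _ = (d : ℂ)⁻¹ * ∑ e ∈ d.divisors, μ e * ρ.character (g ^ e) ^ (d / e) := by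
        rw [← sum_rootChar_neg_mul hζ fun e => ρ.character (g ^ e) ^ (d / e)]
        simp only [trace_tensorPow_comp_cyclicShift]

end CyclicTensorPower

section AdamsOperations

open scoped ArithmeticFunction.Moebius

variable {G : Type*} [Group G]

variable (G) in
/-- The Adams operation `ψ^d` on functions on a group, `ψ^d φ (g) = φ (g ^ d)`. -/
def adams (d : ℕ) : (G → ℂ) →ₗ[ℂ] (G → ℂ) := LinearMap.funLeft ℂ ℂ (· ^ d)

theorem adams_apply (d : ℕ) (φ : G → ℂ) (g : G) : adams G d φ g = φ (g ^ d) := rfl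

theorem adams_one : adams G 1 = LinearMap.id := by
  ext φ g
  simp [adams_apply]

variable [Finite G] {V : Type*} [AddCommGroup V] [Module ℂ V] [FiniteDimensional ℂ V]
  (ρ : Representation ℂ G V) {ζ : ℕ → ℂ}

theorem sum_divisors_mul_character_cyclicTensorPow (hζ : ∀ d, 1 ≤ d → IsPrimitiveRoot (ζ d) d)
    {n : ℕ} (hn : 0 < n) (g : G) :
    ∑ d ∈ n.divisors, d * (cyclicTensorPow ρ d (ζ d)).character (g ^ (n / d)) =
      ρ.character g ^ n := by
  have hmoebius : ∀ d > 0, d ∈ {d | d ∣ n} →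
      ∑ x ∈ d.divisorsAntidiagonal, (μ x.1 : ℂ) * ρ.character (g ^ (n / x.2)) ^ x.2 =
        d * (cyclicTensorPow ρ d (ζ d)).character (g ^ (n / d)) := by
    rintro d hd hdn
    have : NeZero d := ⟨hd.ne'⟩
    rw [character_cyclicTensorPow ρ (hζ d hd), mul_inv_cancel_left₀ (NeZero.ne _),
      Nat.sum_divisorsAntidiagonal fun e f => (μ e : ℂ) * ρ.character (g ^ (n / f)) ^ f]
    refine Finset.sum_congr rfl fun e he => ?_
    have hed := Nat.dvd_of_mem_divisors he
    have hdvd : e ∣ n / (d / e) := Nat.dvd_div_of_mul_dvd ((Nat.div_mul_cancel hed).symm ▸ hdn)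
    rw [← pow_mul, ← Nat.div_div_div_eq_div hed hdn, Nat.div_mul_cancel hdvd]
  rw [(ArithmeticFunction.sum_eq_iff_sum_mul_moebius_eq_on
    (g := fun d => ρ.character (g ^ (n / d)) ^ d) {d | d ∣ n} fun _ _ h₁ h₂ => h₁.trans h₂).mpr
    hmoebius n hn dvd_rfl, Nat.div_self hn, pow_one]

theorem sum_divisors_adams_character_cyclicTensorPow
    (hζ : ∀ d, 1 ≤ d → IsPrimitiveRoot (ζ d) d) {n : ℕ} (hn : 0 < n) :
    ∑ d ∈ n.divisors, (d : ℂ)⁻¹ • adams G d (cyclicTensorPow ρ (n / d) (ζ (n / d))).character =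
      (n : ℂ)⁻¹ • ρ.character ^ n := by
  ext g
  rw [Pi.smul_apply, Pi.pow_apply, ← sum_divisors_mul_character_cyclicTensorPow ρ hζ hn,
    ← Nat.sum_div_divisors, Finset.smul_sum, Finset.sum_apply]
  refine Finset.sum_congr rfl fun d hd => ?_
  have hdn := Nat.dvd_of_mem_divisors hd
  have hd0 : (d : ℂ) ≠ 0 := Nat.cast_ne_zero.mpr (Nat.pos_of_mem_divisors hd).ne'
  have hn0 : (n : ℂ) ≠ 0 := Nat.cast_ne_zero.mpr hn.ne'
  rw [Pi.smul_apply, adams_apply, Nat.div_div_self hdn hn.ne', smul_eq_mul, smul_eq_mul,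
    Nat.cast_div hdn hd0]
  field_simp

end AdamsOperations

section FormalLogarithm

open PowerSeries

variable {A : Type*} [CommRing A] [Algebra ℚ A]

theorem hasSubst_sub_one {R : Type*} [CommRing R] {F : R⟦X⟧} (hF : constantCoeff F = 1) :
    HasSubst (F - 1) :=
  HasSubst.of_constantCoeff_zero' (by rw [map_sub, hF, map_one, sub_self])

theorem derivative_logOf_mul_self {F : A⟦X⟧} (hF : constantCoeff F = 1) :
    d⁄dX A (logOf F) * F = d⁄dX A F := by
  have hgeometric : d⁄dX A (log A) * (1 + X) = 1 := by
    rw [deriv_log]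
    ext n
    cases n with
    | zero => simp
    | succ n => rw [mul_add, mul_one, map_add, coeff_succ_mul_X]; simp [pow_succ, coeff_one]
  have hsubst := congrArg (substAlgHom (R := A) (hasSubst_sub_one hF)) hgeometric
  rw [map_mul, map_add, map_one, substAlgHom_X, add_sub_cancel, coe_substAlgHom] at hsubst
  rw [logOf_eq, derivative_subst (hasSubst_sub_one hF), map_sub, derivative_one, sub_zero,
    mul_right_comm, hsubst, one_mul]

theorem eq_logOf_of_derivative_mul_eq {F L : A⟦X⟧} (hF : constantCoeff F = 1)
    (hL : constantCoeff L = 0) (h : d⁄dX A L * F = d⁄dX A F) : L = logOf F := by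
  have := IsAddTorsionFree.of_module_rat A
  have hunit : IsUnit F := isUnit_iff_constantCoeff.mpr (hF ▸ isUnit_one)
  exact derivative.ext
    (hunit.mul_left_injective (h.trans (derivative_logOf_mul_self hF).symm))
    (hL.trans (constantCoeff_logOf hF).symm)

theorem logOf_one : logOf (1 : A⟦X⟧) = 0 :=
  (eq_logOf_of_derivative_mul_eq (map_one _) (map_zero _) (by simp)).symm

theorem logOf_mul {F H : A⟦X⟧} (hF : constantCoeff F = 1) (hH : constantCoeff H = 1) :
    logOf (F * H) = logOf F + logOf H := by
  refine (eq_logOf_of_derivative_mul_eq (by rw [map_mul, hF, hH, mul_one])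
    (by rw [map_add, constantCoeff_logOf hF, constantCoeff_logOf hH, add_zero]) ?_).symm
  rw [Derivation.leibniz, smul_eq_mul, smul_eq_mul, map_add]
  linear_combination H * derivative_logOf_mul_self hF + F * derivative_logOf_mul_self hH

theorem logOf_prod {ι : Type*} (s : Finset ι) {F : ι → A⟦X⟧}
    (hF : ∀ i ∈ s, constantCoeff (F i) = 1) : logOf (∏ i ∈ s, F i) = ∑ i ∈ s, logOf (F i) := by
  classical
  induction s using Finset.induction_on with
  | empty => exact logOf_one
  | insert i s hi ih =>
    have hs := fun j hj => hF j (Finset.mem_insert_of_mem hj)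
    rw [Finset.prod_insert hi, Finset.sum_insert hi, ← ih hs]
    refine logOf_mul (hF i (Finset.mem_insert_self i s)) ?_
    rw [map_prod, Finset.prod_eq_one hs]

theorem map_logOf {B : Type*} [CommRing B] [Algebra ℚ B] (φ : A →+* B) {F : A⟦X⟧}
    (hF : constantCoeff F = 1) : (logOf F).map φ = logOf (F.map φ) := by
  have hmap := PowerSeries.map_subst (hasSubst_sub_one hF) (h := φ) (log A)
  rw [map_log] at hmap
  exact hmap.trans (congrArg (subst · _) <|
    (map_sub (PowerSeries.map φ) F 1).trans (by rw [map_one]))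

theorem constantCoeff_one_sub_C_mul_X_pow {R : Type*} [CommRing R] (a : R) {n : ℕ} (hn : n ≠ 0) :
    constantCoeff (1 - C a * X ^ n : R⟦X⟧) = 1 := by
  simp [hn]

theorem coeff_logOf_one_sub_C_mul_X_pow (a : A) {n : ℕ} (hn : n ≠ 0) (m : ℕ) :
    coeff m (logOf (1 - C a * X ^ n)) =
      if n ∣ m then -(((m / n : ℕ) : ℚ)⁻¹ • a ^ (m / n)) else 0 := by
  have hexpand : logOf (1 - C a * X ^ n) = expand n hn (rescale (-a) (log A)) := by
    rw [expand_apply, rescale_eq_subst, subst_comp_subst_apply (HasSubst.smul_X' _)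
      (HasSubst.X_pow hn), subst_smul (HasSubst.X_pow hn), subst_X (HasSubst.X_pow hn), logOf_eq]
    congr 1
    rw [neg_smul, smul_eq_C_mul, sub_sub_cancel_left]
  rw [hexpand, coeff_expand]
  congr 1
  obtain hk | hk := eq_or_ne (m / n) 0
  · simp [hk]
  · rw [coeff_rescale, coeff_log, if_neg hk, neg_pow, pow_succ, ← Algebra.commutes,
      ← Algebra.smul_def]
    obtain hsign | hsign := Nat.even_or_odd (m / n) <;>
      simp [hsign.neg_one_pow, neg_div]

theorem coeff_succ_logOf_of_forall_le {F : A⟦X⟧} (hF : constantCoeff F = 1) {n : ℕ}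
    (hlow : ∀ m ≤ n, coeff m (logOf F) = 0) : coeff (n + 1) (logOf F) = coeff (n + 1) F := by
  have := IsAddTorsionFree.of_module_rat A
  have hcoeff := congrArg (coeff n) (derivative_logOf_mul_self hF)
  rw [coeff_mul, Finset.sum_eq_single (n, 0), coeff_derivative, coeff_derivative,
    coeff_zero_eq_constantCoeff_apply, hF, mul_one] at hcoeff
  · refine nsmul_right_injective n.succ_ne_zero ?_
    simpa [nsmul_eq_mul, mul_comm] using hcoeff
  · intro x hx hne
    have hsum := Finset.HasAntidiagonal.mem_antidiagonal.mp hx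
    have hlt : x.1 < n := by
      by_contra! hle
      exact hne (Prod.ext (by grind) (by grind))
    rw [coeff_derivative, hlow _ hlt, zero_mul, zero_mul]
  · simp

end FormalLogarithm

section Integrality

open PowerSeries

theorem sum_Icc_ite_dvd {M : Type*} [AddCommMonoid M] {m N : ℕ} (hm : 1 ≤ m) (hmN : m ≤ N)
    (f : ℕ → ℕ → M) :
    ∑ n ∈ Finset.Icc 1 N, (if n ∣ m then f (m / n) n else 0) =
      ∑ d ∈ m.divisors, f d (m / d) := by
  have hdivisors : {n ∈ Finset.Icc 1 N | n ∣ m} = m.divisors := by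
    ext n
    rw [Finset.mem_filter, Finset.mem_Icc, Nat.mem_divisors]
    exact ⟨fun h => ⟨h.2, by omega⟩, fun h =>
      ⟨⟨Nat.pos_of_dvd_of_pos h.1 hm, (Nat.le_of_dvd hm h.1).trans hmN⟩, h.1⟩⟩
  rw [← Finset.sum_filter, hdivisors, ← Nat.sum_div_divisors]
  exact Finset.sum_congr rfl fun d hd => by
    rw [Nat.div_div_self (Nat.dvd_of_mem_divisors hd) (by omega)]

theorem constantCoeff_map_eq_one {R A : Type*} [CommRing R] [CommRing A] (φ : R →+* A) {F : R⟦X⟧}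
    (hF : constantCoeff F = 1) : constantCoeff (F.map φ) = 1 := by
  rw [← coeff_zero_eq_constantCoeff_apply, coeff_map, coeff_zero_eq_constantCoeff_apply, hF,
    map_one]

theorem exists_map_subtype_eq_of_coeff_mem {A : Type*} [CommRing A] (S : Subring A) {F : A⟦X⟧}
    (hF0 : constantCoeff F = 1) (hF : ∀ n, 1 ≤ n → coeff n F ∈ S) :
    ∃ H : S⟦X⟧, constantCoeff H = 1 ∧ H.map S.subtype = F := by
  have hmem : ∀ n, coeff n F ∈ S
    | 0 => by simp [hF0]
    | n + 1 => hF (n + 1) (by omega)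
  exact ⟨.mk fun n => ⟨coeff n F, hmem n⟩, by ext; simpa using hF0, by ext; simp⟩

variable {A : Type*} [CommRing A] [Algebra ℚ A]

theorem coeff_logOf_mem (S : Subalgebra ℚ A) {F : A⟦X⟧} (hF0 : constantCoeff F = 1)
    (hF : ∀ n, 1 ≤ n → coeff n F ∈ S) (n : ℕ) : coeff n (logOf F) ∈ S := by
  obtain ⟨H, hH, rfl⟩ := exists_map_subtype_eq_of_coeff_mem S.toSubring hF0 hF
  have hmap : (logOf (A := S) H).map S.val.toRingHom = _ := map_logOf _ hH
  rw [show S.toSubring.subtype = S.val.toRingHom from rfl, ← hmap, coeff_map]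
  exact Subtype.property _

/-- The logarithms of the power series with constant term `1` and coefficients in the subring `S`.
The logarithms themselves need not have coefficients in `S`. -/
def logUnits (S : Subring A) : AddSubgroup A⟦X⟧ where
  carrier := {L | ∃ F : S⟦X⟧, constantCoeff F = 1 ∧ logOf (F.map S.subtype) = L}
  zero_mem' := ⟨1, map_one _, by rw [map_one, logOf_one]⟩
  add_mem' := by
    rintro _ _ ⟨F, hF, rfl⟩ ⟨H, hH, rfl⟩
    refine ⟨F * H, by rw [map_mul, hF, hH, mul_one], ?_⟩
    rw [map_mul, logOf_mul (constantCoeff_map_eq_one _ hF) (constantCoeff_map_eq_one _ hH)]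
  neg_mem' := by
    rintro _ ⟨F, hF, rfl⟩
    have hinv : constantCoeff (invOfUnit F 1) = 1 := by simp
    refine ⟨invOfUnit F 1, hinv, eq_neg_of_add_eq_zero_right ?_⟩
    rw [← logOf_mul (constantCoeff_map_eq_one _ hF) (constantCoeff_map_eq_one _ hinv), ← map_mul,
      mul_invOfUnit F 1 hF, map_one, logOf_one]

variable {S : Subring A}

theorem logOf_mem_logUnits {F : A⟦X⟧} (hF0 : constantCoeff F = 1)
    (hF : ∀ n, 1 ≤ n → coeff n F ∈ S) : logOf F ∈ logUnits S := by
  obtain ⟨H, hH, rfl⟩ := exists_map_subtype_eq_of_coeff_mem S hF0 hF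
  exact ⟨H, hH, rfl⟩

theorem coeff_mem_of_mem_logUnits {L : A⟦X⟧} (hL : L ∈ logUnits S) {n : ℕ}
    (hlow : ∀ m, 1 ≤ m → m < n → coeff m L = 0) : coeff n L ∈ S := by
  obtain ⟨F, hF, rfl⟩ := hL
  have hF' : constantCoeff (F.map S.subtype) = 1 := constantCoeff_map_eq_one _ hF
  have hzero : coeff 0 (logOf (F.map S.subtype)) = 0 :=
    (coeff_zero_eq_constantCoeff_apply _).trans (constantCoeff_logOf hF')
  cases n with
  | zero => exact hzero ▸ S.zero_mem
  | succ n =>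
    rw [coeff_succ_logOf_of_forall_le hF', coeff_map]
    · exact Subtype.property _
    · rintro (_ | m) hm
      exacts [hzero, hlow _ (by omega) (by omega)]

variable {ι : Type*} [Fintype ι]

/-- The coefficient of `z^n` in the logarithm of `∏_{m ≥ 1} ∏_i (1 - x_i z^m)^{-k_{m,i}}`. -/
def eulerLogCoeff (x : ι → A) (k : ℕ → ι → ℤ) (n : ℕ) : A :=
  ∑ d ∈ n.divisors, ∑ i, (d : ℚ)⁻¹ • k (n / d) i • x i ^ d

theorem exists_mem_logUnits_coeff_eq_eulerLogCoeff {x : ι → A} (hx : ∀ i, x i ∈ S)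
    (k : ℕ → ι → ℤ) (N : ℕ) :
    ∃ L ∈ logUnits S, ∀ m, 1 ≤ m → m ≤ N → coeff m L = eulerLogCoeff x k m := by
  have hfactor : ∀ i, ∀ n ≠ 0, logOf (1 - C (x i) * X ^ n) ∈ logUnits S := fun i n hn =>
    ⟨1 - C ⟨x i, hx i⟩ * X ^ n, constantCoeff_one_sub_C_mul_X_pow _ hn, by simp⟩
  refine ⟨-∑ n ∈ Finset.Icc 1 N, ∑ i, k n i • logOf (1 - C (x i) * X ^ n), neg_mem <|
    sum_mem fun n hn => sum_mem fun i _ => zsmul_mem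
      (hfactor i n (Nat.pos_iff_ne_zero.mp (Finset.mem_Icc.mp hn).1)) _, fun m hm hmN => ?_⟩
  rw [eulerLogCoeff, ← sum_Icc_ite_dvd hm hmN fun d n => ∑ i, (d : ℚ)⁻¹ • k n i • x i ^ d, map_neg,
    map_sum, ← Finset.sum_neg_distrib]
  refine Finset.sum_congr rfl fun n hn => ?_
  have hn0 : n ≠ 0 := Nat.pos_iff_ne_zero.mp (Finset.mem_Icc.mp hn).1
  simp only [map_sum, map_zsmul, coeff_logOf_one_sub_C_mul_X_pow _ hn0]
  split_ifs
  · simp only [smul_neg, Finset.sum_neg_distrib, neg_neg]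
    exact Finset.sum_congr rfl fun i _ => smul_comm _ _ _
  · simp

theorem coeff_sub_eulerLogCoeff_mem {x : ι → A} (hx : ∀ i, x i ∈ S) (k : ℕ → ι → ℤ)
    {L : A⟦X⟧} (hL : L ∈ logUnits S) {n : ℕ} (hn : 1 ≤ n)
    (hlow : ∀ m, 1 ≤ m → m < n → coeff m L = eulerLogCoeff x k m) :
    coeff n L - eulerLogCoeff x k n ∈ S := by
  obtain ⟨M, hM, hMcoeff⟩ := exists_mem_logUnits_coeff_eq_eulerLogCoeff hx k n
  rw [← hMcoeff n hn le_rfl, ← map_sub]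
  refine coeff_mem_of_mem_logUnits (sub_mem hL hM) fun m hm hmn => ?_
  rw [map_sub, hlow m hm hmn, hMcoeff m hm hmn.le, sub_self]

end Integrality

section Expansions

open PowerSeries

theorem hasSeriesSum_iff {f : ℕ → ℂ⟦X⟧} {s : ℂ⟦X⟧} (hf : ∀ n m, m < n → coeff m (f n) = 0)
    (hs : constantCoeff s = 0) :
    HasSeriesSum f s ↔ ∀ m, 1 ≤ m → ∑ n ∈ Finset.Icc 1 m, coeff m (f n) = coeff m s := by
  have hpartial : ∀ m N, m ≤ N →
      coeff m (∑ n ∈ Finset.Icc 1 N, f n) = ∑ n ∈ Finset.Icc 1 m, coeff m (f n) := by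
    intro m N hmN
    rw [map_sum]
    refine (Finset.sum_subset (Finset.Icc_subset_Icc_right hmN) fun n hnN hnm => hf _ _ ?_).symm
    rw [Finset.mem_Icc] at hnN hnm
    omega
  constructor
  · intro h m _
    obtain ⟨N, hN, hmN⟩ := ((h m).and (Filter.eventually_ge_atTop m)).exists
    rw [← hpartial m N hmN, hN]
  · intro h m
    filter_upwards [Filter.eventually_ge_atTop m] with N hN
    rw [hpartial m N hN]
    rcases Nat.eq_zero_or_pos m with rfl | hm
    · simp [hs]
    · exact h m hm

theorem detSeries_eq_prod {V ι : Type*} [AddCommGroup V] [Module ℂ V] [Fintype ι]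
    {A : V →ₗ[ℂ] V} (b : Module.Basis ι ℂ V) {l : ι → ℂ} (hb : ∀ i, A (b i) = l i • b i)
    (n : ℕ) : detSeries A n = ∏ i, (1 - C (l i) * X ^ n) := by
  classical
  rw [detSeries, ← LinearMap.det_toMatrix (b.baseChange ℂ⟦X⟧), ← Matrix.det_diagonal]
  congr 1
  ext1 i j
  rw [LinearMap.toMatrix_apply]
  simp only [LinearMap.sub_apply, LinearMap.id_apply, LinearMap.smul_apply,
    Module.Basis.baseChange_apply, LinearMap.baseChange_tmul, hb, map_sub,
    TensorProduct.tmul_smul, TensorProduct.smul_tmul', Finsupp.sub_apply,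
    Module.Basis.baseChange_repr_tmul, Module.Basis.repr_self]
  rcases eq_or_ne i j with rfl | hij
  · simp [smul_eq_C_mul, mul_comm]
  · simp [Finsupp.single_eq_of_ne hij, Matrix.diagonal_apply_ne _ hij]

theorem coeff_formalLog_detSeries {G V : Type*} [Group G] [Finite G] [AddCommGroup V] [Module ℂ V]
    [FiniteDimensional ℂ V] (ρ : Representation ℂ G V) (g : G) {n : ℕ} (hn : n ≠ 0) (m : ℕ) :
    coeff m (formalLog (detSeries (ρ g) n)) =
      if n ∣ m then -(((m / n : ℕ) : ℂ)⁻¹ * ρ.character (g ^ (m / n))) else 0 := by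
  obtain ⟨b, l, hb⟩ := exists_eigenbasis_of_representation ρ g
  have hlog : formalLog (detSeries (ρ g) n) = ∑ i, logOf (1 - C (l i) * X ^ n) :=
    (congrArg logOf (detSeries_eq_prod b hb n)).trans <|
      logOf_prod _ fun i _ => constantCoeff_one_sub_C_mul_X_pow (l i) hn
  simp only [hlog, map_sum, coeff_logOf_one_sub_C_mul_X_pow _ hn]
  split_ifs
  · rw [Representation.character, map_pow, trace_pow_of_eigenbasis b hb, Finset.sum_neg_distrib,
      Finset.mul_sum]
    simp only [inv_natCast_smul_eq ℚ ℂ, smul_eq_mul]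
  · simp

variable {G : Type*} {Q : (G → ℂ)⟦X⟧}

theorem formalLog_evalAt (hQ : constantCoeff Q = 1) (g : G) :
    formalLog (evalAt Q g) = (logOf Q).map (Pi.evalRingHom (fun _ : G => ℂ) g) :=
  (map_logOf _ hQ).symm

theorem constantCoeff_formalLog_evalAt (hQ : constantCoeff Q = 1) (g : G) :
    constantCoeff (formalLog (evalAt Q g)) = 0 :=
  constantCoeff_logOf (constantCoeff_map_eq_one _ hQ)

variable [Group G] [Fintype G]

theorem forall_traceExpansionAt_iff (hQ : constantCoeff Q = 1) {q : ℕ → Irr G → ℂ} :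
    (∀ g, TraceExpansionAt Q q g) ↔
      ∀ m, 1 ≤ m → charCombination G (q m) = coeff m (logOf Q) := by
  have hterm : ∀ g n m, coeff m (∑ ρ, (q n ρ * ρ.rep.character g) • (X ^ n : ℂ⟦X⟧)) =
      if n = m then charCombination G (q n) g else 0 := by
    intro g n m
    simp [coeff_X_pow, charCombination_apply, eq_comm, Finset.sum_ite_irrel]
  have hat : ∀ g, TraceExpansionAt Q q g ↔
      ∀ m, 1 ≤ m → charCombination G (q m) g = coeff m (logOf Q) g := by
    intro g
    rw [TraceExpansionAt, hasSeriesSum_iff (fun n m hmn => by rw [hterm, if_neg hmn.ne'])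
      (constantCoeff_formalLog_evalAt hQ g), formalLog_evalAt hQ]
    refine forall₂_congr fun m hm => ?_
    simp [hterm, hm]
  simp only [hat, funext_iff]
  tauto

theorem forall_detExpansionAt_iff (hQ : constantCoeff Q = 1) {b : ℕ → Irr G → ℂ} :
    (∀ g, DetExpansionAt Q b g) ↔ ∀ m : ℕ, 1 ≤ m →
      ∑ d ∈ m.divisors, (d : ℂ)⁻¹ • adams G d (charCombination G (b (m / d))) =
        coeff m (logOf Q) := by
  have hterm : ∀ g n m, n ≠ 0 → coeff m (-∑ ρ, b n ρ • formalLog (detSeries (ρ.rep g) n)) =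
      if n ∣ m then (((m / n : ℕ) : ℂ)⁻¹ • adams G (m / n) (charCombination G (b n))) g
        else 0 := by
    intro g n m hn
    simp only [map_neg, map_sum, coeff_smul, coeff_formalLog_detSeries _ g hn]
    split_ifs
    · simp [adams_apply, charCombination_apply, Finset.mul_sum, mul_left_comm]
    · simp
  have hat : ∀ g, DetExpansionAt Q b g ↔ ∀ m : ℕ, 1 ≤ m →
      (∑ d ∈ m.divisors, (d : ℂ)⁻¹ • adams G d (charCombination G (b (m / d)))) g =
        coeff m (logOf Q) g := by
    intro g
    rw [DetExpansionAt, hasSeriesSum_iff _ (constantCoeff_formalLog_evalAt hQ g),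
      formalLog_evalAt hQ]
    · refine forall₂_congr fun m hm => ?_
      rw [Finset.sum_apply, ← sum_Icc_ite_dvd hm le_rfl
        fun d n => ((d : ℂ)⁻¹ • adams G d (charCombination G (b n))) g]
      exact Eq.congr (Finset.sum_congr rfl fun n hn =>
        hterm g n m (Nat.pos_iff_ne_zero.mp (Finset.mem_Icc.mp hn).1)) (by simp)
    · intro n m hmn
      rw [hterm g n m (by omega)]
      split_ifs with hdvd
      · obtain rfl : m = 0 := Nat.eq_zero_of_dvd_of_lt hdvd hmn
        simp
      · rfl
  simp only [hat, funext_iff]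
  tauto

end Expansions

section DivisorSums

theorem eq_of_sum_divisors_eq {M N : Type*} [AddCancelCommMonoid N] {T : ℕ → M → N}
    (hT : Function.Injective (T 1)) {b b' : ℕ → M}
    (h : ∀ n, 1 ≤ n → ∑ d ∈ n.divisors, T d (b (n / d)) = ∑ d ∈ n.divisors, T d (b' (n / d)))
    {n : ℕ} (hn : 1 ≤ n) : b n = b' n := by
  induction n using Nat.strong_induction_on with
  | _ n ih =>
    have hone : 1 ∈ n.divisors := Nat.one_mem_divisors.mpr (by omega)
    have hrest : ∑ d ∈ n.divisors.erase 1, T d (b (n / d)) =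
        ∑ d ∈ n.divisors.erase 1, T d (b' (n / d)) := by
      refine Finset.sum_congr rfl fun d hd => ?_
      obtain ⟨hd1, hd⟩ := Finset.mem_erase.mp hd
      have hpos := Nat.pos_of_mem_divisors hd
      rw [ih _ (Nat.div_lt_self hn (by omega)) (Nat.div_pos (Nat.divisor_le hd) hpos)]
    have hsum := h n hn
    rw [← Finset.add_sum_erase _ _ hone, ← Finset.add_sum_erase _ _ hone, hrest, add_left_inj,
      Nat.div_one] at hsum
    exact hT hsum

theorem sum_divisors_sum_divisors {M : Type*} [AddCommMonoid M] {n : ℕ} (hn : n ≠ 0)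
    (F : ℕ → ℕ → ℕ → M) :
    ∑ d ∈ n.divisors, ∑ k ∈ (n / d).divisors, F d k (n / d / k) =
      ∑ l ∈ n.divisors, ∑ d ∈ l.divisors, F d (l / d) (n / l) := by
  rw [Finset.sum_sigma', Finset.sum_sigma']
  refine Finset.sum_bij' (fun x _ => ⟨x.1 * x.2, x.1⟩) (fun x _ => ⟨x.2, x.1 / x.2⟩) ?_ ?_ ?_ ?_ ?_
  · rintro ⟨d, k⟩ h
    simp only [Finset.mem_sigma, Nat.mem_divisors] at h ⊢
    have hdk : d * k ∣ n := (Nat.dvd_div_iff_mul_dvd h.1.1).mp h.2.1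
    exact ⟨⟨hdk, hn⟩, dvd_mul_right _ _, ne_zero_of_dvd_ne_zero hn hdk⟩
  · rintro ⟨l, d⟩ h
    simp only [Finset.mem_sigma, Nat.mem_divisors] at h ⊢
    have hdn : d ∣ n := h.2.1.trans h.1.1
    exact ⟨⟨hdn, hn⟩, Nat.div_dvd_div h.2.1 h.1.1, (Nat.div_ne_zero_iff_of_dvd hdn).mpr
      ⟨hn, ne_zero_of_dvd_ne_zero hn hdn⟩⟩
  · rintro ⟨d, k⟩ h
    simp only [Finset.mem_sigma] at h
    simp [Nat.mul_div_cancel_left _ (Nat.pos_of_mem_divisors h.1)]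
  · rintro ⟨l, d⟩ h
    simp only [Finset.mem_sigma] at h
    simp [Nat.mul_div_cancel' (Nat.dvd_of_mem_divisors h.2)]
  · rintro ⟨d, k⟩ h
    simp only [Finset.mem_sigma] at h
    simp [Nat.mul_div_cancel_left _ (Nat.pos_of_mem_divisors h.1), Nat.div_div_eq_div_mul]

end DivisorSums

section Exponents

variable {G : Type*} [Group G] [Fintype G]

theorem eq_sum_divisors_rSeq (q : ℕ → Irr G → ℂ) {n : ℕ} (hn : 1 ≤ n) :
    q n = ∑ d ∈ n.divisors, ∑ γ : Irr G,
      ((d : ℂ)⁻¹ * rSeq q (n / d) γ) • multiplicities (tensorPow γ.rep d).character := by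
  classical
  have hone : {d ∈ n.divisors | ¬ 1 < d} = {1} := by
    ext d
    rw [Finset.mem_filter, Finset.mem_singleton]
    constructor
    · rintro ⟨hd, hd1⟩
      have := Nat.pos_of_mem_divisors hd
      omega
    · rintro rfl
      exact ⟨Nat.one_mem_divisors.mpr (by omega), by omega⟩
  ext ρ
  rw [← Finset.sum_filter_add_sum_filter_not _ (1 < ·), hone, Finset.sum_singleton, Pi.add_apply,
    ← sub_eq_iff_eq_add']
  have hrec := rSeq_eq q n ρ
  convert hrec.symm using 1
  · simp only [Finset.sum_apply, Pi.smul_apply, smul_eq_mul, multiplicities]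
    congr 1
    exact Finset.sum_congr rfl fun d _ => Finset.sum_congr rfl fun γ _ => by ring
  · simp [multiplicities, character_tensorPow, Irr.charPairing_eq]

theorem charCombination_eq_sum_divisors_rSeq (q : ℕ → Irr G → ℂ) {n : ℕ} (hn : 1 ≤ n) :
    charCombination G (q n) = ∑ d ∈ n.divisors, ∑ γ : Irr G,
      ((d : ℂ)⁻¹ * rSeq q (n / d) γ) • γ.rep.character ^ d := by
  conv_lhs => rw [eq_sum_divisors_rSeq q hn, map_sum]
  refine Finset.sum_congr rfl fun d hd => ?_
  have : NeZero d := ⟨(Nat.pos_of_mem_divisors hd).ne'⟩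
  simp only [map_sum, map_smul, charCombination_multiplicities_character]
  simp only [character_tensorPow]

/-- The exponents of the Euler product predicted from the trace coefficients `q` by the cyclic
tensor powers: `b_{n,ρ} = ∑_{d ∣ n} ∑_γ ⟨γ^{⊗cyc d}, ρ⟩ r_{n/d,γ}`. -/
def cyclicExponent (ζ : ℕ → ℂ) (q : ℕ → Irr G → ℂ) (n : ℕ) (ρ : Irr G) : ℂ :=
  ∑ d ∈ n.divisors, ∑ γ : Irr G,
    charPairing (cyclicTensorPow γ.rep d (ζ d)).character ρ.rep.character * rSeq q (n / d) γ

theorem charCombination_cyclicExponent (ζ : ℕ → ℂ) (q : ℕ → Irr G → ℂ) (n : ℕ) :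
    charCombination G (cyclicExponent ζ q n) = ∑ d ∈ n.divisors, ∑ γ : Irr G,
      rSeq q (n / d) γ • (cyclicTensorPow γ.rep d (ζ d)).character := by
  have hexponent : cyclicExponent ζ q n = ∑ d ∈ n.divisors, ∑ γ : Irr G,
      rSeq q (n / d) γ • multiplicities (cyclicTensorPow γ.rep d (ζ d)).character := by
    ext ρ
    simp [cyclicExponent, multiplicities, mul_comm]
  rw [hexponent, map_sum]
  refine Finset.sum_congr rfl fun d hd => ?_
  have : NeZero d := ⟨(Nat.pos_of_mem_divisors hd).ne'⟩
  simp only [map_sum, map_smul, charCombination_multiplicities_character]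

theorem sum_divisors_adams_charCombination_cyclicExponent {ζ : ℕ → ℂ}
    (hζ : ∀ d, 1 ≤ d → IsPrimitiveRoot (ζ d) d) (q : ℕ → Irr G → ℂ) {n : ℕ} (hn : 1 ≤ n) :
    ∑ d ∈ n.divisors, (d : ℂ)⁻¹ • adams G d (charCombination G (cyclicExponent ζ q (n / d))) =
      charCombination G (q n) := by
  simp only [charCombination_cyclicExponent, map_sum, map_smul, Finset.smul_sum]
  rw [sum_divisors_sum_divisors (by omega) fun d k m => ∑ γ : Irr G,
    (d : ℂ)⁻¹ • rSeq q m γ • adams G d (cyclicTensorPow γ.rep k (ζ k)).character,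
    charCombination_eq_sum_divisors_rSeq q hn]
  refine Finset.sum_congr rfl fun l hl => ?_
  rw [Finset.sum_comm]
  refine Finset.sum_congr rfl fun γ _ => ?_
  rw [mul_comm, mul_smul, ← sum_divisors_adams_character_cyclicTensorPow γ.rep hζ
    (Nat.pos_of_mem_divisors hl), Finset.smul_sum]
  exact Finset.sum_congr rfl fun d _ => smul_comm _ _ _

end Exponents

section IntegralExponents

open PowerSeries

variable {G : Type*} [Group G] [Fintype G]

theorem charCombination_sub_eulerLogCoeff {q : ℕ → Irr G → ℂ} {k : ℕ → Irr G → ℤ} {n : ℕ}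
    (hn : 1 ≤ n) (hk : ∀ m, 1 ≤ m → m < n → ∀ γ, rSeq q m γ = k m γ) :
    charCombination G (q n) - eulerLogCoeff (fun γ => γ.rep.character) k n =
      charCombination G (rSeq q n) - ∑ γ, k n γ • γ.rep.character := by
  have hone : 1 ∈ n.divisors := Nat.one_mem_divisors.mpr (by omega)
  have hproper : ∑ d ∈ n.divisors.erase 1, ∑ γ : Irr G,
      ((d : ℂ)⁻¹ * rSeq q (n / d) γ) • γ.rep.character ^ d =
        ∑ d ∈ n.divisors.erase 1, ∑ γ, (d : ℚ)⁻¹ • k (n / d) γ • γ.rep.character ^ d := by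
    refine Finset.sum_congr rfl fun d hd => Finset.sum_congr rfl fun γ _ => ?_
    obtain ⟨hd1, hd⟩ := Finset.mem_erase.mp hd
    have hpos := Nat.pos_of_mem_divisors hd
    rw [hk _ (Nat.div_pos (Nat.divisor_le hd) hpos) (Nat.div_lt_self hn (by omega)), mul_smul,
      Int.cast_smul_eq_zsmul, inv_natCast_smul_eq ℚ ℂ]
  rw [charCombination_eq_sum_divisors_rSeq q hn, eulerLogCoeff, ← Finset.add_sum_erase _ _ hone,
    ← Finset.add_sum_erase _ _ hone, hproper, add_sub_add_right_eq_sub]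
  simp [charCombination_apply]

theorem charCombination_eq_eulerLogCoeff {q : ℕ → Irr G → ℂ} {k : ℕ → Irr G → ℤ} {n : ℕ}
    (hn : 1 ≤ n) (hk : ∀ m, 1 ≤ m → m ≤ n → ∀ γ, rSeq q m γ = k m γ) :
    charCombination G (q n) = eulerLogCoeff (fun γ => γ.rep.character) k n := by
  rw [← sub_eq_zero, charCombination_sub_eulerLogCoeff hn fun m hm hmn => hk m hm hmn.le]
  simp [charCombination_apply, hk n hn le_rfl, Int.cast_smul_eq_zsmul]

theorem exists_int_rSeq {L : (G → ℂ)⟦X⟧} (hL : L ∈ logUnits (integralVirtualCharRing G))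
    {q : ℕ → Irr G → ℂ} (hq : ∀ n, 1 ≤ n → charCombination G (q n) = coeff n L) {n : ℕ}
    (hn : 1 ≤ n) (γ : Irr G) : ∃ k : ℤ, rSeq q n γ = k := by
  induction n using Nat.strong_induction_on generalizing γ with
  | _ n ih =>
    choose! k hk using ih
    have hirr : ∀ γ : Irr G, γ.rep.character ∈ integralVirtualCharRing G := fun γ =>
      Submodule.subset_span ⟨γ, rfl⟩
    have hdiff := coeff_sub_eulerLogCoeff_mem hirr k hL hn fun m hm hmn =>
      (hq m hm).symm.trans <| charCombination_eq_eulerLogCoeff hm fun j hj hjm =>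
        hk j (hjm.trans_lt hmn) hj
    rw [← hq n hn, charCombination_sub_eulerLogCoeff hn fun m hm hmn => hk m hmn hm] at hdiff
    have hsum : ∑ γ, k n γ • γ.rep.character ∈ integralVirtualCharRing G :=
      sum_mem fun γ _ => zsmul_mem (hirr γ) _
    refine exists_int_of_charCombination_mem ?_ γ
    exact sub_add_cancel (charCombination G (rSeq q n)) _ ▸ add_mem hdiff hsum

theorem exists_int_cyclicExponent {q : ℕ → Irr G → ℂ} (ζ : ℕ → ℂ)
    (hr : ∀ n, 1 ≤ n → ∀ γ, ∃ k : ℤ, rSeq q n γ = k) (n : ℕ) (ρ : Irr G) :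
    ∃ k : ℤ, cyclicExponent ζ q n ρ = k := by
  have hmem : cyclicExponent ζ q n ρ ∈ (Int.castRingHom ℂ).range := by
    refine sum_mem fun d hd => sum_mem fun γ _ => mul_mem ?_ ?_
    · have : NeZero d := ⟨(Nat.pos_of_mem_divisors hd).ne'⟩
      obtain ⟨k, hk⟩ := exists_int_multiplicities_character (cyclicTensorPow γ.rep d (ζ d)) ρ
      exact ⟨k, hk.symm⟩
    · obtain ⟨k, hk⟩ := hr (n / d) (Nat.div_pos (Nat.divisor_le hd) (Nat.pos_of_mem_divisors hd)) γ
      exact ⟨k, hk.symm⟩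
  obtain ⟨k, hk⟩ := hmem
  exact ⟨k, hk.symm⟩

end IntegralExponents

section ExpansionCoefficients

open PowerSeries

variable {G : Type*} [Group G] [Fintype G] {Q : (G → ℂ)⟦X⟧}

omit [Fintype G] in
theorem coeff_logOf_mem_virtualChar (hQ0 : constantCoeff Q = 1)
    (hQ : ∀ n, 1 ≤ n → coeff n Q ∈ virtualChar G) (n : ℕ) : coeff n (logOf Q) ∈ virtualChar G := by
  simp only [← toSubmodule_virtualCharAlgebra] at hQ ⊢
  exact coeff_logOf_mem ((virtualCharAlgebra G).restrictScalars ℚ) hQ0 hQ n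

theorem eq_of_forall_traceExpansionAt (hQ0 : constantCoeff Q = 1) {q q' : ℕ → Irr G → ℂ}
    (hq : ∀ g, TraceExpansionAt Q q g) (hq' : ∀ g, TraceExpansionAt Q q' g) {n : ℕ}
    (hn : 1 ≤ n) : q n = q' n :=
  charCombination_injective <| ((forall_traceExpansionAt_iff hQ0).mp hq n hn).trans
    ((forall_traceExpansionAt_iff hQ0).mp hq' n hn).symm

theorem eq_of_forall_detExpansionAt (hQ0 : constantCoeff Q = 1) {b b' : ℕ → Irr G → ℂ}
    (hb : ∀ g, DetExpansionAt Q b g) (hb' : ∀ g, DetExpansionAt Q b' g) {n : ℕ}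
    (hn : 1 ≤ n) : b n = b' n := by
  refine eq_of_sum_divisors_eq
    (T := fun d a => (d : ℂ)⁻¹ • adams G d (charCombination G a)) ?_ (fun m hm => ?_) hn
  · simpa [adams_one] using charCombination_injective
  · exact ((forall_detExpansionAt_iff hQ0).mp hb m hm).trans
      ((forall_detExpansionAt_iff hQ0).mp hb' m hm).symm

theorem forall_detExpansionAt_cyclicExponent {ζ : ℕ → ℂ}
    (hζ : ∀ d, 1 ≤ d → IsPrimitiveRoot (ζ d) d) (hQ0 : constantCoeff Q = 1)
    {q : ℕ → Irr G → ℂ} (hq : ∀ g, TraceExpansionAt Q q g) (g : G) :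
    DetExpansionAt Q (cyclicExponent ζ q) g :=
  (forall_detExpansionAt_iff hQ0).mpr (fun n hn =>
    (sum_divisors_adams_charCombination_cyclicExponent hζ q hn).trans
      ((forall_traceExpansionAt_iff hQ0).mp hq n hn)) g

end ExpansionCoefficients

end FrobEuler

end

open FrobEuler in
theorem mainTheorem6_general {G : Type*} [Group G] [Fintype G]
    (ζ : ℕ → ℂ) (hζ : ∀ d : ℕ, 1 ≤ d → IsPrimitiveRoot (ζ d) d)
    (Q : (G → ℂ)⟦X⟧) (hQ0 : PowerSeries.constantCoeff Q = 1)
    (hQ : ∀ n : ℕ, 1 ≤ n → PowerSeries.coeff n Q ∈ virtualChar G) :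
    ∃ q b : ℕ → Irr G → ℂ,
      ((∀ g, TraceExpansionAt Q q g) ∧
        ∀ q', (∀ g, TraceExpansionAt Q q' g) → ∀ n, 1 ≤ n → q' n = q n) ∧
      ((∀ g, DetExpansionAt Q b g) ∧
        ∀ b', (∀ g, DetExpansionAt Q b' g) → ∀ n, 1 ≤ n → b' n = b n) ∧
      (∀ n, 1 ≤ n → ∀ ρ : Irr G, b n ρ = ∑ d ∈ n.divisors, ∑ γ : Irr G,
        charPairing (cyclicTensorPow γ.rep d (ζ d)).character ρ.rep.character *
          rSeq q (n / d) γ) ∧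
      ((∀ n, 1 ≤ n → PowerSeries.coeff n Q ∈ integralVirtualChar G) →
        ∀ n, 1 ≤ n → ∀ ρ : Irr G, ∃ k : ℤ, b n ρ = k) := by
  let q : ℕ → Irr G → ℂ := fun n => multiplicities (PowerSeries.coeff n (PowerSeries.logOf Q))
  have hcoeff : ∀ n, 1 ≤ n →
      charCombination G (q n) = PowerSeries.coeff n (PowerSeries.logOf Q) := fun n _ =>
    charCombination_multiplicities (coeff_logOf_mem_virtualChar hQ0 hQ n)
  have htrace : ∀ g, TraceExpansionAt Q q g := (forall_traceExpansionAt_iff hQ0).mpr hcoeff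
  have hdet : ∀ g, DetExpansionAt Q (cyclicExponent ζ q) g :=
    forall_detExpansionAt_cyclicExponent hζ hQ0 htrace
  refine ⟨q, cyclicExponent ζ q,
    ⟨htrace, fun q' hq' n hn => eq_of_forall_traceExpansionAt hQ0 hq' htrace hn⟩,
    ⟨hdet, fun b' hb' n hn => eq_of_forall_detExpansionAt hQ0 hb' hdet hn⟩,
    fun n _ ρ => rfl, fun hQZ n _ ρ => exists_int_cyclicExponent ζ (fun m hm γ => ?_) n ρ⟩
  exact exists_int_rSeq (logOf_mem_logUnits hQ0 hQZ) hcoeff hm γ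

theorem mainTheorem6 (E : Type*) [Field E] [NumberField E]
    (ζ : ℕ → ℂ) (hζ : ∀ d : ℕ, 1 ≤ d → IsPrimitiveRoot (ζ d) d)
    (Q : (Gal(E/ℚ) → ℂ)⟦X⟧) (hQ0 : PowerSeries.constantCoeff Q = 1)
    (hQ : ∀ n : ℕ, 1 ≤ n → PowerSeries.coeff n Q ∈ FrobEuler.virtualChar Gal(E/ℚ)) :
    ∃ q b : ℕ → FrobEuler.Irr Gal(E/ℚ) → ℂ,
      ((∀ g, FrobEuler.TraceExpansionAt Q q g) ∧
        ∀ q', (∀ g, FrobEuler.TraceExpansionAt Q q' g) → ∀ n, 1 ≤ n → q' n = q n) ∧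
      ((∀ g, FrobEuler.DetExpansionAt Q b g) ∧
        ∀ b', (∀ g, FrobEuler.DetExpansionAt Q b' g) → ∀ n, 1 ≤ n → b' n = b n) ∧
      (∀ (p : ℕ) (σ : Gal(E/ℚ)), FrobEuler.IsFrobAtUnramified E p σ →
        FrobEuler.TraceExpansionAt Q q σ ∧ FrobEuler.DetExpansionAt Q b σ) ∧
      (∀ n, 1 ≤ n → ∀ ρ : FrobEuler.Irr Gal(E/ℚ),
        b n ρ = ∑ d ∈ n.divisors, ∑ γ : FrobEuler.Irr Gal(E/ℚ),
          FrobEuler.charPairing (FrobEuler.cyclicTensorPow γ.rep d (ζ d)).character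
            ρ.rep.character * FrobEuler.rSeq q (n / d) γ) ∧
      ((∀ n, 1 ≤ n → PowerSeries.coeff n Q ∈ FrobEuler.integralVirtualChar Gal(E/ℚ)) →
        ∀ n, 1 ≤ n → ∀ ρ : FrobEuler.Irr Gal(E/ℚ), ∃ k : ℤ, b n ρ = k) := by
  obtain ⟨q, b, hq, hb, hformula, hint⟩ := mainTheorem6_general ζ hζ Q hQ0 hQ
  exact ⟨q, b, hq, hb, fun _ σ _ => ⟨hq.1 σ, hb.1 σ⟩, hformula, hint⟩
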